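/- A (finite) Kripke game consists of a finite set $P$ of players, a finite set $W$ of worlds and, for each player $p\in P$, a finite non-empty set $S_p$ of strategies, an equivalence relation $\equiv_p$ on $W$, and, for each world $w\in W$, a payoff function $u_p^w:\prod_{q\in P}S_q\to\mathbb R$. Write $[w]_p=\{v\in W : v\equiv_p w\}$ and let $[W]_p$ be the set of $\equiv_p$-classes. A pure strategy of player $p$ is a map $[W]_p\to S_p$; a mixed strategy of $p$ is a probability distribution on the set $S_p^{[W]_p}$ of her pure strategies; a play is a product distribution $\sigma=\prod_{p\in P}\sigma_p$, where each $\sigma_p$ is a mixed strategy of player $p$. If $X=(X_p)_{p\in P}$ has law $\sigma$ (so that the $X_p$ are independent with laws $\sigma_p$), put $X(v)=(X_p([v]_p))_{p\in P}\in\prod_{p\in P}S_p$ for $v\in W$, and define the payoff of player $p$ in world $w$ by \[ \mathrm{pay}_p^w(\sigma)=\min_{v\in[w]_p}\mathbb E\big[u_p^v(X(v))\big]. \] A play $\sigma$ is an equilibrium if for every player $p\in P$, every world $w\in W$ and every mixed strategy $\sigma_p'$ of $p$ one has $\mathrm{pay}_p^w(\sigma)\ge\mathrm{pay}_p^w(\sigma')$,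 where $\sigma'$ is obtained from $\sigma$ by replacing the factor $\sigma_p$ by $\sigma_p'$. Theorem. Every Kripke game has an equilibrium play. -/

import Mathlib

universe u v w

/-- A Kripke game with players `P` on worlds `W`. -/
structure KripkeGame (P : Type u) (W : Type v) where
  /-- The set of strategies of each player (the same in all worlds). -/
  Strategy : P → Type w
  /-- Strategy sets are finite. -/
  finite_strategy : ∀ p, Finite (Strategy p)
  /-- The equivalence relation of each player on the worlds. -/
  equiv : P → Setoid W
  /-- The payoff of player `p` in world `x`. -/
  utility : (p : P) → (x : W) → ((q : P) → Strategy q) → ℝ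

namespace KripkeGame

variable {P : Type u} {W : Type v}

/-- The set of equivalence classes of worlds for player `p`. -/
abbrev WorldClass (G : KripkeGame.{u, v, w} P W) (p : P) : Type v :=
  Quotient (G.equiv p)

/-- The equivalence class of the world `x` for player `p`. -/
abbrev classOf (G : KripkeGame.{u, v, w} P W) (p : P) (x : W) : G.WorldClass p :=
  Quotient.mk (G.equiv p) x

/-- A pure strategy of player `p`: a map from her equivalence classes to her strategies. -/
abbrev PureStrategy (G : KripkeGame.{u, v, w} P W) (p : P) : Type (max v w) :=
  G.WorldClass p → G.Strategy p

noncomputable instance pureStrategyFintype [Finite W] (G : KripkeGame.{u, v, w} P W) (p : P) :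
    Fintype (G.PureStrategy p) :=
  haveI := G.finite_strategy p
  Fintype.ofFinite _

/-- A mixed strategy of player `p`: a probability distribution over her pure strategies. -/
abbrev MixedStrategy [Finite W] (G : KripkeGame.{u, v, w} P W) (p : P) : Type (max v w) :=
  stdSimplex ℝ (G.PureStrategy p)

/-- A play, given by its factors: one mixed strategy for each player. The product distribution
that it determines is `KripkeGame.law`. -/
abbrev Play [Finite W] (G : KripkeGame.{u, v, w} P W) : Type (max u v w) :=
  (p : P) → G.MixedStrategy p

/-- A profile of pure strategies, i.e. a value of a play instance. -/
abbrev PureProfile (G : KripkeGame.{u, v, w} P W) : Type (max u v w) :=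
  (p : P) → G.PureStrategy p

/-- The specialization of a profile of pure strategies to the world `x`. -/
def specialize (G : KripkeGame.{u, v, w} P W) (s : G.PureProfile) (x : W) :
    (p : P) → G.Strategy p :=
  fun p => s p (G.classOf p x)

/-- The product distribution of a play: the players draw their pure strategies
independently. -/
noncomputable def law [Fintype P] [DecidableEq P] [Finite W] (G : KripkeGame.{u, v, w} P W)
    (σ : G.Play) : stdSimplex ℝ G.PureProfile :=
  ⟨fun s => ∏ p, (σ p : G.PureStrategy p → ℝ) (s p),
    fun s => Finset.prod_nonneg fun p _ => (σ p).2.1 (s p), by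
      rw [← Fintype.prod_sum (fun p t => (σ p : G.PureStrategy p → ℝ) t)]
      exact Finset.prod_eq_one fun p _ => (σ p).2.2⟩

/-- The expected payoff of player `p` computed in the world `x`, when the profile of pure
strategies is drawn from the law of `σ` and specialized to `x`. -/
noncomputable def expectedPayoff [Fintype P] [DecidableEq P] [Finite W]
    (G : KripkeGame.{u, v, w} P W) (σ : G.Play) (p : P) (x : W) : ℝ :=
  ∑ s : G.PureProfile, (G.law σ : G.PureProfile → ℝ) s * G.utility p x (G.specialize s x)

open Classical in
/-- The worlds in the equivalence class of `x` for player `p`, as a finite set. -/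
noncomputable def classFinset [Fintype W] (G : KripkeGame.{u, v, w} P W) (p : P) (x : W) :
    Finset W :=
  Finset.univ.filter fun y => (G.equiv p) y x

theorem classFinset_nonempty [Fintype W] (G : KripkeGame.{u, v, w} P W) (p : P) (x : W) :
    (G.classFinset p x).Nonempty :=
  ⟨x, by simp [classFinset]⟩

/-- The payoff of player `p` in the world `x`: the minimum of her expected payoffs over the
worlds that she cannot distinguish from `x`. -/
noncomputable def payoff [Fintype P] [DecidableEq P] [Fintype W]
    (G : KripkeGame.{u, v, w} P W) (σ : G.Play) (p : P) (x : W) : ℝ :=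
  (G.classFinset p x).inf' (G.classFinset_nonempty p x) fun y => G.expectedPayoff σ p y

/-- Player `p` tolerates `σ` if in no world can she gain by changing her own mixed strategy. -/
def Tolerates [Fintype P] [DecidableEq P] [Fintype W]
    (G : KripkeGame.{u, v, w} P W) (p : P) (σ : G.Play) : Prop :=
  ∀ (x : W) (τ : G.MixedStrategy p), G.payoff (Function.update σ p τ) p x ≤ G.payoff σ p x

/-- An equilibrium is a play that every player tolerates. -/
def IsEquilibrium [Fintype P] [DecidableEq P] [Fintype W]
    (G : KripkeGame.{u, v, w} P W) (σ : G.Play) : Prop :=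
  ∀ p : P, G.Tolerates p σ

end KripkeGame

/-!
Let every player act as a separate agent in each of her classes of worlds. Expected payoffs in a
world `y` involve only the marginals at the classes of `y`, and any family of marginals is attained
by product distributions, so it suffices to find an equilibrium of the game between the agents.
There the payoff of an agent is a minimum of functions that are linear in her own distribution,
hence concave, and Nash's theorem for concave games applies.

That theorem is Ky Fan's inequality for `φ σ τ = ∑ i, u i (update σ i (τ i))`. Ky Fan's inequality
reduces, by compactness, to the closed-cover theorem for the simplex, which is the limit of a
combinatorial statement about colorings of the integer points of a dilated simplex. The latter comes
from Scarf's lemma, proved by double counting modulo 2 the pairs of a dominant set (a room) and a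
wall of it that misses a fixed color only (a door).
-/

section Counting

open Finset

variable {α β : Type*} [DecidableEq α]

theorem image_erase_eq_image_iff [DecidableEq β] {s : Finset α} {f : α → β} {a : α} (ha : a ∈ s) :
    (s.erase a).image f = s.image f ↔ ∃ b ∈ s, b ≠ a ∧ f b = f a := by
  constructor
  · intro h
    have hfa : f a ∈ (s.erase a).image f := h ▸ mem_image_of_mem f ha
    grind
  · rintro ⟨b, hb, hba, hf⟩
    ext y
    grind

theorem card_filter_image_erase_eq_two [DecidableEq β] {s : Finset α} {f : α → β}
    (hcard : #s = #(s.image f) + 1) : #{a ∈ s | (s.erase a).image f = s.image f} = 2 := by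
  obtain ⟨a, ha, b, hb, hab, hf⟩ := exists_ne_map_eq_of_card_lt_of_maps_to
    (t := s.image f) (by lia) fun x hx => mem_image_of_mem f hx
  have hinj : Set.InjOn f (s.erase a) := by
    rw [← card_image_iff, (image_erase_eq_image_iff ha).2 ⟨b, hb, hab.symm, hf.symm⟩,
      card_erase_of_mem ha]
    lia
  have hpair : {x ∈ s | (s.erase x).image f = s.image f} = {a, b} := by
    ext x
    rw [mem_filter, and_congr_right fun hx => image_erase_eq_image_iff hx, mem_insert,
      mem_singleton]
    constructor
    · rintro ⟨hx, y, hy, hyx, hfy⟩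
      by_contra! hne
      rcases eq_or_ne y a with rfl | hya
      · exact hne.2 (hinj (by simp [hx, hne.1]) (by simp [hb, hab.symm]) (hfy.symm.trans hf))
      · exact hyx (hinj (by simp [hy, hya]) (by simp [hx, hne.1]) hfy)
    · rintro (rfl | rfl)
      · exact ⟨ha, b, hb, hab.symm, hf.symm⟩
      · exact ⟨hb, a, ha, hab, hf⟩
  rw [hpair, card_pair hab]

theorem even_card_filter_image_erase [Fintype β] [DecidableEq β] {s : Finset α} {f : α → β}
    (b : β) (hs : s.image f ≠ univ) :
    Even #{a ∈ s | #(s.erase a) + 1 = Fintype.card β ∧ (s.erase a).image f = univ.erase b} := by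
  by_cases himg : #s = Fintype.card β ∧ s.image f = univ.erase b
  · have hcard : #s = #(s.image f) + 1 := by
      rw [himg.2, card_erase_add_one (mem_univ b), himg.1, card_univ]
    have hfilter : ∀ a ∈ s, #(s.erase a) + 1 = Fintype.card β ∧
        (s.erase a).image f = univ.erase b ↔ (s.erase a).image f = s.image f := fun a ha => by
      simp only [card_erase_add_one ha, himg, true_and]
    rw [filter_congr hfilter, card_filter_image_erase_eq_two hcard]
    exact even_two
  · rw [filter_eq_empty_iff.2, card_empty]
    · exact Even.zero
    · rintro a ha ⟨hcard, hea⟩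
      rw [card_erase_add_one ha] at hcard
      have hins : s.image f = insert (f a) (univ.erase b) := by
        rw [← hea, ← image_insert, insert_erase ha]
      rcases eq_or_ne (f a) b with hb | hb
      · exact hs (by rw [hins, hb, insert_erase (mem_univ b)])
      · exact himg ⟨hcard, by rw [hins, insert_eq_of_mem (by simp [hb])]⟩

theorem sum_card_insert_eq_sum_card_erase [Fintype α] (p r : Finset α → Prop) [DecidablePred p]
    [DecidablePred r] :
    ∑ S with p S, #{z | z ∉ S ∧ r (insert z S)} = ∑ R with r R, #{z ∈ R | p (R.erase z)} := by
  rw [← card_sigma, ← card_sigma]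
  refine card_bij' (fun a _ => ⟨insert a.2 a.1, a.2⟩) (fun a _ => ⟨a.1.erase a.2, a.2⟩) ?_ ?_ ?_ ?_
  all_goals simp +contextual [insert_erase]

end Counting

section Dominance

open Finset

variable {X ι α : Type*} [LinearOrder α] {k : ι → X → α} {S : Finset X} {m : ι → X}

/-- Given a family `k` of rankings of `X`, a finite set `S` is dominant if every point of `X` is
ranked, by at least one of the rankings, no higher than any point of `S`. -/
def IsDominant (k : ι → X → α) (S : Finset X) : Prop :=
  ∀ y, ∃ i, ∀ x ∈ S, k i y ≤ k i x

/-- A choice, for each ranking `k i`, of a lowest point `m i` of `S`. -/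
structure IsMinSelector (k : ι → X → α) (S : Finset X) (m : ι → X) : Prop where
  mem : ∀ i, m i ∈ S
  le : ∀ i, ∀ x ∈ S, k i (m i) ≤ k i x

/-- The points ranked strictly higher than the selected points `m i` by all rankings other than
`k j`. If `m` selects the lowest points of a dominant set, only `k j` can witness dominance at these
points. -/
def exceeding (k : ι → X → α) (m : ι → X) (j : ι) : Set X :=
  {y | ∀ i ≠ j, k i (m i) < k i y}

theorem IsDominant.mono {R : Finset X} (hR : IsDominant k R) (hSR : S ⊆ R) : IsDominant k S :=
  fun y => (hR y).imp fun _ hi x hx => hi x (hSR hx)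

theorem exists_isMinSelector (k : ι → X → α) (hS : S.Nonempty) : ∃ m, IsMinSelector k S m := by
  choose m hm hle using fun i => exists_min_image S (k i) hS
  exact ⟨m, hm, hle⟩

theorem IsMinSelector.eq_of_forall_le (hm : IsMinSelector k S m) {i : ι}
    (hk : Function.Injective (k i)) {x : X} (hx : x ∈ S) (hle : ∀ x' ∈ S, k i x ≤ k i x') :
    m i = x :=
  hk (le_antisymm (hm.le i x hx) (hle _ (hm.mem i)))

theorem IsDominant.exists_rank_le (hS : IsDominant k S) (hm : IsMinSelector k S m) (y : X) :
    ∃ i, k i y ≤ k i (m i) :=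
  (hS y).imp fun i hi => hi _ (hm.mem i)

theorem IsDominant.index_eq_of_mem_exceeding (hS : IsDominant k S) (hm : IsMinSelector k S m)
    {j j' : ι} {z : X} (hj : z ∈ exceeding k m j) (hj' : z ∈ exceeding k m j') : j = j' := by
  obtain ⟨i, hi⟩ := hS.exists_rank_le hm z
  have heq : ∀ j, z ∈ exceeding k m j → i = j := fun j hj => by
    by_contra hij
    exact hi.not_gt (hj i hij)
  rw [← heq j hj, ← heq j' hj']

variable [DecidableEq X]

theorem IsDominant.image_eq [Fintype ι] (hS : IsDominant k S) (hm : IsMinSelector k S m)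
    (hk : ∀ i, Function.Injective (k i)) : univ.image m = S := by
  refine Subset.antisymm (image_subset_iff.2 fun i _ => hm.mem i) fun x hx => ?_
  obtain ⟨i, hi⟩ := hS x
  exact mem_image.2 ⟨i, mem_univ i, hm.eq_of_forall_le (hk i) hx hi⟩

theorem notMem_of_mem_exceeding [Fintype ι] [DecidableEq ι] {j : ι} {z : X}
    (hj : (univ.erase j).image m = S) (hz : z ∈ exceeding k m j) : z ∉ S := by
  rw [← hj, mem_image]
  rintro ⟨i, hi, rfl⟩
  exact (hz i (ne_of_mem_erase hi)).false

theorem IsDominant.insert_of_isMaxOn (hS : IsDominant k S) (hm : IsMinSelector k S m) {j : ι}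
    {z : X} (hz : z ∈ exceeding k m j) (hmax : IsMaxOn (k j) (exceeding k m j) z) :
    IsDominant k (insert z S) := by
  intro y
  suffices ∃ i, k i y ≤ k i z ∧ k i y ≤ k i (m i) from this.imp fun i hi =>
    forall_mem_insert .. |>.2 ⟨hi.1, fun x hx => hi.2.trans (hm.le i x hx)⟩
  by_cases hy : y ∈ exceeding k m j
  · obtain ⟨i, hi⟩ := hS.exists_rank_le hm y
    obtain rfl : i = j := by
      by_contra hij
      exact hi.not_gt (hy i hij)
    exact ⟨i, hmax hy, hi⟩
  · obtain ⟨i, hij, hi⟩ : ∃ i, i ≠ j ∧ k i y ≤ k i (m i) := by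
      simpa only [exceeding, Set.mem_ofPred_eq, not_forall, not_lt, exists_prop] using hy
    exact ⟨i, hi.trans (hz i hij).le, hi⟩

theorem IsDominant.isMaxOn_exceeding {j : ι} {z : X} (hd : IsDominant k (insert z S))
    (hm : IsMinSelector k S m) : IsMaxOn (k j) (exceeding k m j) z := by
  intro y hy
  obtain ⟨i, hi⟩ := hd y
  obtain rfl : i = j := by
    by_contra hij
    exact (hi _ (mem_insert_of_mem (hm.mem i))).not_gt (hy i hij)
  exact hi z (mem_insert_self z S)

theorem IsDominant.exists_mem_exceeding_of_insert [Fintype ι] [DecidableEq ι] {z : X}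
    (hd : IsDominant k (insert z S)) (hm : IsMinSelector k S m)
    (hk : ∀ i, Function.Injective (k i)) (hcard : #S + 1 = Fintype.card ι) (hz : z ∉ S) :
    ∃ j, (univ.erase j).image m = S ∧ z ∈ exceeding k m j := by
  obtain ⟨j, hj⟩ := hd z
  have hbelow : ∀ x ∈ S, ∃ i, k i x < k i z ∧ m i = x := fun x hx => by
    obtain ⟨i, hi⟩ := hd x
    have hxz : x ≠ z := ne_of_mem_of_not_mem hx hz
    exact ⟨i, (hi z (mem_insert_self z S)).lt_of_ne ((hk i).ne hxz),
      hm.eq_of_forall_le (hk i) hx fun x' hx' => hi x' (mem_insert_of_mem hx')⟩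
  have himage : ∀ A : Finset ι, (∀ i, k i (m i) < k i z → i ∈ A) → A.image m = S := fun A hA => by
    refine Subset.antisymm (image_subset_iff.2 fun i _ => hm.mem i) fun x hx => ?_
    obtain ⟨i, hi, rfl⟩ := hbelow x hx
    exact mem_image_of_mem m (hA i hi)
  have hle : k j z ≤ k j (m j) := hj _ (mem_insert_of_mem (hm.mem j))
  refine ⟨j, himage _ fun i hi => mem_erase.2 ⟨?_, mem_univ i⟩, fun i hij => ?_⟩
  · rintro rfl
    exact hi.not_ge hle
  · -- Otherwise the `card ι - 2` indices other than `i` and `j` would already select all of `S`.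
    by_contra! hiz
    have hS : ((univ.erase j).erase i).image m = S := himage _ fun l hl => by
      simp only [mem_erase, mem_univ, and_true]
      exact ⟨by rintro rfl; exact hl.not_ge hiz, by rintro rfl; exact hl.not_ge hle⟩
    have hcard_le := card_image_le (s := (univ.erase j).erase i) (f := m)
    have hcard_i := card_erase_add_one (mem_erase.2 ⟨hij, mem_univ i⟩)
    have hcard_j := card_erase_add_one (mem_univ j)
    rw [hS] at hcard_le
    rw [card_univ] at hcard_j
    lia

theorem IsDominant.card_insert_eq_two [Fintype X] [Fintype ι] [DecidablePred (IsDominant k)]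
    (hS : IsDominant k S) (hk : ∀ i, Function.Injective (k i)) (hne : S.Nonempty)
    (hcard : #S + 1 = Fintype.card ι)
    (hexceed : ∀ j, ∃ y, ∀ i ≠ j, ∃ x ∈ S, k i x < k i y) :
    #{z | z ∉ S ∧ IsDominant k (insert z S)} = 2 := by
  classical
  obtain ⟨m, hm⟩ := exists_isMinSelector k hne
  have hmax : ∀ j, ∃ z ∈ exceeding k m j, IsMaxOn (k j) (exceeding k m j) z := fun j => by
    obtain ⟨y, hy⟩ := hexceed j
    refine Set.exists_max_image _ (k j) (Set.toFinite _) ⟨y, fun i hij => ?_⟩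
    obtain ⟨x, hx, hlt⟩ := hy i hij
    exact (hm.le i x hx).trans_lt hlt
  choose g hg hgmax using hmax
  have himage := hS.image_eq hm hk
  have htwo : #{j | (univ.erase j).image m = S} = 2 := by
    rw [← himage]
    exact card_filter_image_erase_eq_two (by rw [himage, hcard, card_univ])
  rw [← htwo]
  symm
  refine card_bij (fun j _ => g j) (fun j hj => ?_) (fun j _ j' _ hjj' => ?_) fun z hz => ?_
  · exact mem_filter.2 ⟨mem_univ _, notMem_of_mem_exceeding (mem_filter.1 hj).2 (hg j),
      hS.insert_of_isMaxOn hm (hg j) (hgmax j)⟩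
  · exact hS.index_eq_of_mem_exceeding hm (hg j) (hjj' ▸ hg j')
  · obtain ⟨hzS, hd⟩ := (mem_filter.1 hz).2
    obtain ⟨j, hj, hzj⟩ := hd.exists_mem_exceeding_of_insert hm hk hcard hzS
    exact ⟨j, mem_filter.2 ⟨mem_univ j, hj⟩,
      hk j (le_antisymm (hd.isMaxOn_exceeding hm (hg j)) (hgmax j hzj))⟩

end Dominance

section Scarf

open Finset

variable {T ι α : Type*} [LinearOrder α]

/-- Scarf's rankings of the points of `T` together with one slack point `Sum.inr i` for each index
`i`, which is the lowest point for the ranking `k i` and lies above all of `T` for the other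
rankings. -/
structure IsSlackRanking (k : ι → T ⊕ ι → α) : Prop where
  injective : ∀ i, Function.Injective (k i)
  inr_self_le : ∀ i z, k i (Sum.inr i) ≤ k i z
  inl_lt_inr : ∀ i j t, i ≠ j → k i (Sum.inl t) < k i (Sum.inr j)

/-- The value of a point of `T ⊕ ι` in the ranking that extends `f i` to the slack points. -/
def slackValue [DecidableEq ι] (f : ι → T → α) (i : ι) : T ⊕ ι → WithBot (WithTop α) :=
  Sum.elim (fun t => ((f i t : WithTop α) : WithBot (WithTop α))) fun j => if j = i then ⊥ else ⊤

theorem exists_isSlackRanking [Finite T] [Finite ι] (f : ι → T → α) :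
    ∃ k : ι → T ⊕ ι → WithBot (WithTop α) ×ₗ ℕ, IsSlackRanking k ∧
      ∀ i t t', k i (Sum.inl t) ≤ k i (Sum.inl t') → f i t ≤ f i t' := by
  classical
  obtain ⟨e, he⟩ := Countable.exists_injective_nat (T ⊕ ι)
  refine ⟨fun i z => toLex (slackValue f i z, e z), ⟨fun i z z' h => ?_, fun i z => ?_,
    fun i j t hij => ?_⟩, fun i t t' h => ?_⟩
  · exact he (Prod.ext_iff.1 (toLex.injective h)).2
  · rcases eq_or_ne z (Sum.inr i) with rfl | hz
    · rfl
    · refine (Prod.Lex.toLex_lt_toLex.2 (Or.inl ?_)).le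
      rcases z with t | j
      · simp [slackValue]
      · have hji : j ≠ i := fun h => hz (h ▸ rfl)
        simp [slackValue, hji, bot_lt_iff_ne_bot]
  · refine Prod.Lex.toLex_lt_toLex.2 (Or.inl ?_)
    have : ((f i t : WithTop α) : WithBot (WithTop α)) < ⊤ :=
      WithBot.coe_lt_coe.2 (WithTop.coe_lt_top (f i t))
    simpa [slackValue, hij.symm] using this
  · have hle : slackValue f i (Sum.inl t) ≤ slackValue f i (Sum.inl t') :=
      (Prod.Lex.toLex_le_toLex.1 h).elim LT.lt.le fun h => h.1.le
    simpa [slackValue] using hle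

section Parity

variable [Fintype ι] [DecidableEq ι] {k : ι → T ⊕ ι → α}

theorem eq_image_inr_erase [DecidableEq T] {i₀ : ι} {c : T → ι} {S : Finset (T ⊕ ι)}
    (hS : S.image (Sum.elim c id) = univ.erase i₀) (hT : ∀ t, Sum.inl t ∉ S) :
    S = (univ.erase i₀).image Sum.inr := by
  rw [← hS, image_image]
  refine image_id.symm.trans (image_congr fun z hz => ?_)
  rcases z with t | i
  · exact absurd hz (hT t)
  · rfl

theorem IsSlackRanking.isDominant_insert_iff [DecidableEq T] (hk : IsSlackRanking k) {i₀ : ι}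
    {z : T ⊕ ι} (hz : z ∉ (univ.erase i₀).image (Sum.inr : ι → T ⊕ ι)) :
    IsDominant k (insert z ((univ.erase i₀).image Sum.inr)) ↔
      ∀ y ∉ (univ.erase i₀).image Sum.inr, k i₀ y ≤ k i₀ z := by
  constructor
  · intro hd y hy
    obtain ⟨i, hi⟩ := hd y
    obtain rfl : i = i₀ := by
      by_contra hne
      have hmem : (Sum.inr i : T ⊕ ι) ∈ (univ.erase i₀).image Sum.inr := by simp [hne]
      have := (hk.injective i) ((hi _ (mem_insert_of_mem hmem)).antisymm (hk.inr_self_le i y))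
      exact hy (this ▸ hmem)
    exact hi z (mem_insert_self z _)
  · intro hmax y
    rcases y with t | j
    · refine ⟨i₀, (forall_mem_insert ..).2 ⟨hmax _ (by simp), fun x hx => ?_⟩⟩
      obtain ⟨j, hj, rfl⟩ := mem_image.1 hx
      exact (hk.inl_lt_inr i₀ j t (ne_of_mem_erase hj).symm).le
    · exact ⟨j, fun x _ => hk.inr_self_le j x⟩

theorem IsSlackRanking.card_isDominant_insert_image_inr [Fintype T] [DecidableEq T]
    (hk : IsSlackRanking k) (i₀ : ι) [DecidablePred (IsDominant k)] :
    #{z | z ∉ (univ.erase i₀).image Sum.inr ∧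
      IsDominant k (insert z ((univ.erase i₀).image Sum.inr))} = 1 := by
  obtain ⟨w, hw, hmax⟩ := exists_max_image ((univ.erase i₀).image (Sum.inr : ι → T ⊕ ι))ᶜ (k i₀)
    ⟨Sum.inr i₀, by simp⟩
  simp only [mem_compl] at hw hmax
  refine card_eq_one.2 ⟨w, ext fun z => ?_⟩
  simp only [mem_filter, mem_univ, true_and, mem_singleton]
  constructor
  · rintro ⟨hz, hd⟩
    exact hk.injective i₀ ((hmax z hz).antisymm ((hk.isDominant_insert_iff hz).1 hd w hw))
  · rintro rfl
    exact ⟨hw, (hk.isDominant_insert_iff hw).2 hmax⟩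

theorem IsSlackRanking.even_card_isDominant_insert [Fintype T] [DecidableEq T]
    (hk : IsSlackRanking k) {S : Finset (T ⊕ ι)} (hcard : #S + 1 = Fintype.card ι) {t : T}
    (ht : Sum.inl t ∈ S) [DecidablePred (IsDominant k)] :
    Even #{z | z ∉ S ∧ IsDominant k (insert z S)} := by
  by_cases hS : IsDominant k S
  · rw [hS.card_insert_eq_two hk.injective ⟨_, ht⟩ hcard fun j =>
      ⟨Sum.inr j, fun i hij => ⟨Sum.inl t, ht, hk.inl_lt_inr i j t hij⟩⟩]
    exact even_two
  · rw [filter_eq_empty_iff.2 fun z _ hz => hS (hz.2.mono (subset_insert z S)), card_empty]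
    exact Even.zero

theorem IsSlackRanking.exists_isDominant_image_eq_univ [Finite T] (hk : IsSlackRanking k)
    (i₀ : ι) (c : T → ι) : ∃ R, IsDominant k R ∧ R.image (Sum.elim c id) = univ := by
  classical
  have := Fintype.ofFinite T
  by_contra! hno
  set IsDoor : Finset (T ⊕ ι) → Prop := fun S =>
    #S + 1 = Fintype.card ι ∧ S.image (Sum.elim c id) = univ.erase i₀
  set S₀ : Finset (T ⊕ ι) := (univ.erase i₀).image Sum.inr
  have hS₀ : S₀ ∈ ({S | IsDoor S} : Finset _) := by
    refine mem_filter.2 ⟨mem_univ _, ?_, ?_⟩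
    · rw [card_image_of_injective _ Sum.inr_injective, card_erase_add_one (mem_univ _), card_univ]
    · rw [image_image, Sum.elim_comp_inr, image_id]
  have hrooms : Even (∑ R with IsDominant k R, #{z ∈ R | IsDoor (R.erase z)}) :=
    even_sum _ fun R hR => even_card_filter_image_erase i₀ (hno R (mem_filter.1 hR).2)
  have hdoors : Even (∑ S ∈ ({S | IsDoor S} : Finset _).erase S₀,
      #{z | z ∉ S ∧ IsDominant k (insert z S)}) := even_sum _ fun S hS => by
    obtain ⟨hne, hS⟩ := mem_erase.1 hS
    obtain ⟨hcard, himage⟩ := (mem_filter.1 hS).2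
    obtain ⟨t, ht⟩ : ∃ t, Sum.inl t ∈ S := by
      by_contra! hT
      exact hne (eq_image_inr_erase himage hT)
    exact hk.even_card_isDominant_insert hcard ht
  rw [← sum_card_insert_eq_sum_card_erase IsDoor (IsDominant k), ← add_sum_erase _ _ hS₀,
    hk.card_isDominant_insert_image_inr] at hrooms
  exact Nat.not_even_one ((Nat.even_add.1 hrooms).2 hdoors)

end Parity

/-- Scarf's lemma. -/
theorem exists_isDominant_comp_color [Finite T] [Finite ι] (f : ι → T → α) (c : T → ι) :
    ∃ R : Finset T, IsDominant (fun z : R => f (c z)) R := by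
  classical
  have := Fintype.ofFinite ι
  cases isEmpty_or_nonempty T
  · exact ⟨∅, isEmptyElim⟩
  obtain ⟨k, hk, hkf⟩ := exists_isSlackRanking f
  obtain ⟨R, hR, himage⟩ :=
    hk.exists_isDominant_image_eq_univ (c (Classical.arbitrary T)) c
  refine ⟨R.preimage Sum.inl Sum.inl_injective.injOn, fun y => ?_⟩
  obtain ⟨i, hi⟩ := hR (Sum.inl y)
  obtain ⟨t | j, hz, rfl⟩ := mem_image.1 (himage ▸ mem_univ i)
  · exact ⟨⟨t, mem_preimage.2 hz⟩, fun x hx => hkf (c t) y x (hi _ (mem_preimage.1 hx))⟩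
  · exact absurd (hk.injective j ((hk.inr_self_le j _).antisymm (hi _ hz))) Sum.inr_ne_inl

end Scarf

section Simplex

open Filter Finset Topology

variable {ι : Type*} [Fintype ι]

theorem le_add_of_sum_le_sum_add {α : Type*} [AddCommMonoid α] [PartialOrder α]
    [IsOrderedCancelAddMonoid α] {m x : ι → α} {d : α} (hmx : m ≤ x)
    (hsum : ∑ i, x i ≤ ∑ i, m i + d) (i : ι) : x i ≤ m i + d := by
  classical
  refine le_of_add_le_add_right (a := ∑ j ∈ univ.erase i, m j) ?_
  calc x i + ∑ j ∈ univ.erase i, m j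
    _ ≤ x i + ∑ j ∈ univ.erase i, x j := by gcongr with j; exact hmx j
    _ = ∑ j, x j := add_sum_erase _ _ (mem_univ i)
    _ ≤ ∑ j, m j + d := hsum
    _ = m i + d + ∑ j ∈ univ.erase i, m j := by
      rw [← add_sum_erase _ _ (mem_univ i), add_right_comm]

theorem exists_sum_eq_forall_mem_lt {C : Finset ι} (hC : C.Nonempty) {m : ι → ℕ} {N : ℕ}
    (hN : ∑ i ∈ C, (m i + 1) ≤ N) : ∃ y : ι → ℕ, ∑ i, y i = N ∧ ∀ i ∈ C, m i < y i := by
  classical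
  obtain ⟨i₀, -⟩ := hC
  obtain ⟨d, rfl⟩ := exists_add_of_le hN
  refine ⟨(fun i => if i ∈ C then m i + 1 else 0) + Pi.single i₀ d, ?_, fun i hi => ?_⟩
  · simp only [Pi.add_apply, sum_add_distrib, sum_ite_mem, univ_inter, sum_pi_single',
      mem_univ, if_true]
  · rw [Pi.add_apply, if_pos hi]
    lia

theorem exists_le_of_forall_exists_forall_le {R : Finset (ι → ℕ)} (hR : R.Nonempty)
    {C : Finset ι} (hC : C.Nonempty) {N : ℕ}
    (hdom : ∀ y : ι → ℕ, ∑ j, y j = N → ∃ i ∈ C, ∀ x ∈ R, y i ≤ x i) :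
    ∃ m : ι → ℕ, (∀ x ∈ R, m ≤ x) ∧ (∀ i ∉ C, m i = 0) ∧ N ≤ ∑ i, m i + Fintype.card ι := by
  classical
  choose b hbR hb using fun i => exists_min_image R (fun x => x i) hR
  refine ⟨fun i => if i ∈ C then b i i else 0, fun x hx i => ?_, fun i hi => if_neg hi, ?_⟩
  · by_cases hi : i ∈ C
    · simpa only [if_pos hi] using hb i x hx
    · simp only [if_neg hi, zero_le]
  · suffices N < ∑ i ∈ C, (b i i + 1) by
      rw [sum_add_distrib, sum_const, smul_eq_mul, mul_one] at this
      have hcard := card_le_univ C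
      rw [sum_ite_mem, univ_inter]
      lia
    by_contra! hle
    obtain ⟨y, hy, hlt⟩ := exists_sum_eq_forall_mem_lt hC hle
    obtain ⟨i, hi, hyi⟩ := hdom y hy
    exact (hlt i hi).not_ge (hyi _ (hbR i))

theorem exists_finset_forall_exists_color_le (N : ℕ) (c : (ι → ℕ) → ι) :
    ∃ R : Finset (ι → ℕ), (∀ x ∈ R, ∑ j, x j = N) ∧
      ∀ y : ι → ℕ, ∑ j, y j = N → ∃ z ∈ R, ∀ x ∈ R, y (c z) ≤ x (c z) := by
  classical
  obtain ⟨R, hR⟩ := exists_isDominant_comp_color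
    (fun i (a : univ.piAntidiag N) => (a : ι → ℕ) i) fun a => c a.1
  refine ⟨R.map (Function.Embedding.subtype _), ?_, fun y hy => ?_⟩
  · exact (forall_mem_map ..).2 fun x _ => (mem_piAntidiag.1 x.2).1
  · obtain ⟨z, hz⟩ := hR ⟨y, mem_piAntidiag.2 ⟨hy, fun i _ => mem_univ i⟩⟩
    exact ⟨z, mem_map_of_mem _ z.2, (forall_mem_map ..).2 hz⟩

theorem exists_forall_exists_color_dist_le [Nonempty ι] (N : ℕ) (c : (ι → ℕ) → ι) :
    ∃ a : ι → ℕ, ∑ j, a j = N ∧ ∀ i, Fintype.card ι < a i →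
      ∃ b : ι → ℕ, ∑ j, b j = N ∧ c b = i ∧ dist b a ≤ Fintype.card ι := by
  classical
  obtain ⟨R, hsum, hdom⟩ := exists_finset_forall_exists_color_le N c
  obtain ⟨a, ha, -⟩ := hdom (Pi.single (Classical.arbitrary ι) N) (by simp)
  obtain ⟨m, hmle, hm0, hmsum⟩ := exists_le_of_forall_exists_forall_le ⟨a, ha⟩
    ⟨_, mem_image_of_mem c ha⟩ fun y hy => exists_mem_image.2 (hdom y hy)
  have hle : ∀ x ∈ R, ∀ i, x i ≤ m i + Fintype.card ι := fun x hx =>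
    le_add_of_sum_le_sum_add (hmle x hx) ((hsum x hx).trans_le hmsum)
  refine ⟨a, hsum a ha, fun i hi => ?_⟩
  have hiC : i ∈ R.image c := by
    by_contra hiC
    simpa [hm0 i hiC, hi.not_ge] using hle a ha i
  obtain ⟨z, hz, hzi⟩ := mem_image.1 hiC
  refine ⟨z, hsum z hz, hzi, (dist_pi_le_iff (Nat.cast_nonneg _)).2 fun j => ?_⟩
  have hza := (hle z hz j).trans (Nat.add_le_add_right (hmle a ha j) _)
  have haz := (hle a ha j).trans (Nat.add_le_add_right (hmle z hz j) _)
  rw [Nat.dist_eq, abs_sub_le_iff, sub_le_iff_le_add', sub_le_iff_le_add']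
  exact ⟨by exact_mod_cast hza, by exact_mod_cast haz⟩

theorem inv_smul_natCast_mem_stdSimplex {N : ℕ} (hN : N ≠ 0) {a : ι → ℕ} (ha : ∑ j, a j = N) :
    (N : ℝ)⁻¹ • (fun j => (a j : ℝ)) ∈ stdSimplex ℝ ι := by
  refine ⟨fun j => ?_, ?_⟩
  · simp only [Pi.smul_apply, smul_eq_mul]
    positivity
  · simp only [Pi.smul_apply, smul_eq_mul, ← mul_sum, ← Nat.cast_sum, ha]
    exact inv_mul_cancel₀ (Nat.cast_ne_zero.2 hN)

theorem exists_forall_exists_mem_dist_le_of_cover_stdSimplex [Nonempty ι] {F : ι → Set (ι → ℝ)}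
    (hF : ∀ x ∈ stdSimplex ℝ ι, ∃ i, x ∈ F i) {ε : ℝ} (hε : 0 < ε) :
    ∃ x ∈ stdSimplex ℝ ι, ∀ i, ε < x i → ∃ y ∈ F i, dist y x ≤ ε := by
  obtain ⟨N, hN⟩ := exists_nat_gt ((Fintype.card ι : ℝ) / ε)
  have hN0 : (0 : ℝ) < N := lt_of_le_of_lt (by positivity) hN
  have hmesh : (Fintype.card ι : ℝ) ≤ ε * N := ((div_lt_iff₀' hε).1 hN).le
  set s : (ι → ℕ) → ι → ℝ := fun a => (N : ℝ)⁻¹ • fun j => (a j : ℝ)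
  have hs : ∀ a : ι → ℕ, ∑ j, a j = N → s a ∈ stdSimplex ℝ ι := fun a =>
    inv_smul_natCast_mem_stdSimplex (Nat.cast_ne_zero.1 hN0.ne')
  choose! c hc using fun a ha => hF (s a) (hs a ha)
  obtain ⟨a, ha, hcolor⟩ := exists_forall_exists_color_dist_le N c
  refine ⟨s a, hs a ha, fun i hi => ?_⟩
  have hai : Fintype.card ι < a i := by
    have : ε < (N : ℝ)⁻¹ * a i := hi
    rw [lt_inv_mul_iff₀' hN0] at this
    exact_mod_cast hmesh.trans_lt this
  obtain ⟨b, hb, rfl, hdist⟩ := hcolor i hai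
  refine ⟨s b, hc b hb, ?_⟩
  have hcast : dist (fun j => (b j : ℝ)) (fun j => (a j : ℝ)) ≤ Fintype.card ι :=
    (dist_pi_le_iff (Nat.cast_nonneg _)).2 fun j => by
      rw [Nat.dist_cast_real]
      exact (dist_le_pi_dist b a j).trans hdist
  rw [dist_smul₀, norm_inv, Real.norm_of_nonneg hN0.le, inv_mul_le_iff₀ hN0, mul_comm]
  exact hcast.trans hmesh

theorem exists_mem_of_closed_cover_stdSimplex [Nonempty ι] {F : ι → Set (ι → ℝ)}
    (hcl : ∀ i, IsClosed (F i)) (hF : ∀ x ∈ stdSimplex ℝ ι, ∃ i, x ∈ F i) :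
    ∃ x ∈ stdSimplex ℝ ι, ∀ i, 0 < x i → x ∈ F i := by
  choose x hx hxF using fun n : ℕ => exists_forall_exists_mem_dist_le_of_cover_stdSimplex hF
    (Nat.one_div_pos_of_nat (α := ℝ) (n := n))
  obtain ⟨x₀, hx₀, φ, hφ, hlim⟩ := (isCompact_stdSimplex (𝕜 := ℝ) ι).tendsto_subseq hx
  refine ⟨x₀, hx₀, fun i hi => ?_⟩
  have hε : Tendsto (fun n => 1 / ((φ n : ℝ) + 1)) atTop (𝓝 0) :=
    tendsto_one_div_add_atTop_nhds_zero_nat.comp hφ.tendsto_atTop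
  have hlarge : ∀ᶠ n in atTop, 1 / ((φ n : ℝ) + 1) < x (φ n) i :=
    hε.eventually_lt (((continuous_apply i).tendsto x₀).comp hlim) hi
  choose! y hyF hyx using hxF
  have hdist : Tendsto (fun n => dist (x (φ n)) (y (φ n) i)) atTop (𝓝 0) :=
    squeeze_zero' (Eventually.of_forall fun n => dist_nonneg)
      (hlarge.mono fun n hn => (dist_comm _ _).trans_le (hyx _ i hn)) hε
  exact (hcl i).mem_of_tendsto (hlim.congr_dist hdist) (hlarge.mono fun n hn => hyF _ i hn)

end Simplex

section KyFan

variable {E : Type*} [AddCommGroup E] [Module ℝ E]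

theorem convex_sum_mem_of_forall_pos {ι : Type*} [Fintype ι] {s : Set E} (hs : Convex ℝ s)
    {a : ι → ℝ} (ha : a ∈ stdSimplex ℝ ι) {z : ι → E} (hz : ∀ i, 0 < a i → z i ∈ s) :
    ∑ i, a i • z i ∈ s := by
  rw [← Finset.sum_filter_of_ne (p := fun i => a i ≠ 0) fun i _ hi => left_ne_zero_of_smul hi]
  refine hs.sum_mem (fun i _ => ha.1 i) ?_ fun i hi =>
    hz i ((ha.1 i).lt_of_ne' (Finset.mem_filter.1 hi).2)
  rw [Finset.sum_filter_ne_zero]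
  exact ha.2

theorem isClosed_setOf_forall_le {X ι β : Type*} [TopologicalSpace X] [TopologicalSpace β]
    [Preorder β] [OrderClosedTopology β] {s : Set X} (hs : IsClosed s) {g : ι → X → β}
    (hg : ∀ i, ContinuousOn (g i) s) (i : ι) : IsClosed {x ∈ s | ∀ j, g j x ≤ g i x} := by
  have : Nonempty ι := ⟨i⟩
  have hinter : {x ∈ s | ∀ j, g j x ≤ g i x} = ⋂ j, {x ∈ s | g j x ≤ g i x} := by
    ext x
    simp [forall_and]
  rw [hinter]
  exact isClosed_iInter fun j => hs.isClosed_le (hg j) (hg i)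

variable [TopologicalSpace E] [ContinuousAdd E] [ContinuousSMul ℝ E]

theorem exists_forall_le_diag_of_finite {ι : Type*} [Finite ι] [Nonempty ι] {K : Set E}
    (hconv : Convex ℝ K) {φ : E → E → ℝ} (hcont : ∀ y ∈ K, ContinuousOn (fun x => φ x y) K)
    (hconc : ∀ x ∈ K, QuasiconcaveOn ℝ K (φ x)) {τ : ι → E} (hτ : ∀ i, τ i ∈ K) :
    ∃ x ∈ K, ∀ i, φ x (τ i) ≤ φ x x := by
  have := Fintype.ofFinite ι
  set mix : (ι → ℝ) → E := fun a => ∑ i, a i • τ i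
  have hmix : Continuous mix := by fun_prop
  have hmixK : ∀ a ∈ stdSimplex ℝ ι, mix a ∈ K := fun a ha =>
    hconv.sum_mem (fun i _ => ha.1 i) ha.2 fun i _ => hτ i
  have hclosed := isClosed_setOf_forall_le (isClosed_stdSimplex ℝ ι) fun i =>
    (hcont (τ i) (hτ i)).comp hmix.continuousOn hmixK
  obtain ⟨a, ha, hbest⟩ := exists_mem_of_closed_cover_stdSimplex hclosed fun a ha =>
    (Finite.exists_max fun i => φ (mix a) (τ i)).imp fun i hi => ⟨ha, hi⟩
  refine ⟨mix a, hmixK a ha, fun j => ?_⟩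
  have hmem : mix a ∈ {y ∈ K | φ (mix a) (τ j) ≤ φ (mix a) y} :=
    convex_sum_mem_of_forall_pos (hconc _ (hmixK a ha) _) ha fun i hi => ⟨hτ i, (hbest i hi).2 j⟩
  exact hmem.2

/-- Ky Fan's inequality. -/
theorem exists_forall_le_diag {K : Set E} (hne : K.Nonempty) (hcomp : IsCompact K)
    (hconv : Convex ℝ K) {φ : E → E → ℝ} (hcont : ∀ y ∈ K, ContinuousOn (fun x => φ x y) K)
    (hdiag : ContinuousOn (fun x => φ x x) K) (hconc : ∀ x ∈ K, QuasiconcaveOn ℝ K (φ x)) :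
    ∃ x ∈ K, ∀ y ∈ K, φ x y ≤ φ x x := by
  have := isCompact_iff_compactSpace.1 hcomp
  have hinter : (⋂ y : K, {x : K | φ x y ≤ φ x x}).Nonempty := by
    refine CompactSpace.iInter_nonempty (fun y => ?_) fun s => ?_
    · exact isClosed_le (hcont y y.2).domRestrict hdiag.domRestrict
    · rcases s.eq_empty_or_nonempty with rfl | hs
      · have := hne.to_subtype
        simp
      · have := hs.to_subtype
        obtain ⟨x, hx, hle⟩ := exists_forall_le_diag_of_finite hconv hcont hconc
          fun y : s => y.1.2
        exact ⟨⟨x, hx⟩, Set.mem_iInter₂.2 fun y hy => hle ⟨y, hy⟩⟩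
  obtain ⟨x, hx⟩ := hinter
  exact ⟨x, x.2, fun y hy => Set.mem_iInter.1 hx ⟨y, hy⟩⟩

end KyFan

section ConcaveGame

open Function

variable {ι : Type*} {E : ι → Type*}

theorem concaveOn_sum_apply [Fintype ι] [∀ i, AddCommGroup (E i)] [∀ i, Module ℝ (E i)]
    {K : ∀ i, Set (E i)} (hconv : ∀ i, Convex ℝ (K i)) {f : ∀ i, E i → ℝ}
    (hf : ∀ i, ConcaveOn ℝ (K i) (f i)) :
    ConcaveOn ℝ (Set.univ.pi K) fun τ => ∑ i, f i (τ i) := by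
  have hconvK : Convex ℝ (Set.univ.pi K) := convex_pi fun i _ => hconv i
  have hproj : ∀ i, ConcaveOn ℝ (Set.univ.pi K) fun τ => f i (τ i) := fun i =>
    ((hf i).comp_linearMap (LinearMap.proj i)).subset (fun τ hτ => hτ i (Set.mem_univ i)) hconvK
  simpa only [Finset.sum_fn] using Finset.sum_induction (fun i τ => f i (τ i))
    (ConcaveOn ℝ (Set.univ.pi K)) (fun _ _ => ConcaveOn.add) (concaveOn_const 0 hconvK)
    fun i _ => hproj i

variable [DecidableEq ι]

theorem update_mem_univ_pi {K : ∀ i, Set (E i)} {σ : ∀ i, E i} (hσ : σ ∈ Set.univ.pi K) {i : ι}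
    {t : E i} (ht : t ∈ K i) : update σ i t ∈ Set.univ.pi K :=
  Set.update_mem_pi_iff_of_mem hσ |>.2 fun _ => ht

theorem sum_update_update_apply [Fintype ι] (u : ι → (∀ i, E i) → ℝ) (σ : ∀ i, E i) (i : ι)
    (t : E i) : ∑ j, u j (update σ j (update σ i t j)) =
      u i (update σ i t) + ∑ j ∈ Finset.univ.erase i, u j σ := by
  rw [← Finset.add_sum_erase _ _ (Finset.mem_univ i), update_self]
  congr 1
  refine Finset.sum_congr rfl fun j hj => ?_
  rw [update_of_ne (Finset.ne_of_mem_erase hj), update_eq_self]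

variable [∀ i, AddCommGroup (E i)] [∀ i, Module ℝ (E i)] [∀ i, TopologicalSpace (E i)]
  [∀ i, ContinuousAdd (E i)] [∀ i, ContinuousSMul ℝ (E i)]

/-- Nash's theorem for concave games. -/
theorem exists_forall_update_le [Finite ι] {K : ∀ i, Set (E i)} (hne : ∀ i, (K i).Nonempty)
    (hcomp : ∀ i, IsCompact (K i)) (hconv : ∀ i, Convex ℝ (K i)) {u : ι → (∀ i, E i) → ℝ}
    (hcont : ∀ i, ContinuousOn (u i) (Set.univ.pi K))
    (hconc : ∀ i, ∀ σ ∈ Set.univ.pi K, ConcaveOn ℝ (K i) fun t => u i (update σ i t)) :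
    ∃ σ ∈ Set.univ.pi K, ∀ i, ∀ t ∈ K i, u i (update σ i t) ≤ u i σ := by
  have := Fintype.ofFinite ι
  have hconvK : Convex ℝ (Set.univ.pi K) := convex_pi fun i _ => hconv i
  obtain ⟨σ, hσ, hmax⟩ := exists_forall_le_diag (Set.univ_pi_nonempty_iff.2 hne)
    (isCompact_univ_pi hcomp) hconvK (φ := fun σ τ => ∑ i, u i (update σ i (τ i)))
    (fun τ hτ => continuousOn_finsetSum _ fun i _ => (hcont i).comp
      (continuous_id.update i continuous_const).continuousOn
      fun σ hσ => update_mem_univ_pi hσ (hτ i (Set.mem_univ i)))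
    (by simpa only [update_eq_self] using continuousOn_finsetSum _ fun i _ => hcont i)
    fun σ hσ => (concaveOn_sum_apply hconv fun i => hconc i σ hσ).quasiconcaveOn
  refine ⟨σ, hσ, fun i t ht => ?_⟩
  have hle := hmax _ (update_mem_univ_pi hσ ht)
  rw [sum_update_update_apply] at hle
  simp only [update_eq_self] at hle
  rwa [← Finset.add_sum_erase _ _ (Finset.mem_univ i), add_le_add_iff_right] at hle

end ConcaveGame

section Distributions

theorem sum_prod_mul_comp_eq_sum_prod_map {P : Type*} [Fintype P] [DecidableEq P] {X Y : P → Type*}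
    [∀ p, Fintype (X p)] [∀ p, Fintype (Y p)] (σ : ∀ p, stdSimplex ℝ (X p)) (π : ∀ p, X p → Y p)
    (f : (∀ p, Y p) → ℝ) :
    ∑ s : ∀ p, X p, (∏ p, σ p (s p)) * f (fun p => π p (s p)) =
      ∑ a, (∏ p, stdSimplex.map (π p) (σ p) (a p)) * f a := by
  classical
  rw [← Finset.sum_fiberwise _ fun s p => π p (s p)]
  refine Finset.sum_congr rfl fun a _ => ?_
  have hfiber : ({s | (fun p => π p (s p)) = a} : Finset (∀ p, X p)) =
      Fintype.piFinset fun p => {x | π p x = a p} := by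
    ext s
    simp [funext_iff]
  simp only [stdSimplex.map_coe, FunOnFinite.linearMap_apply_apply, Finset.prod_univ_sum,
    Finset.sum_mul, hfiber]
  refine Finset.sum_congr rfl fun s hs => ?_
  have hsa : (fun p => π p (s p)) = a :=
    funext fun p => by simpa using Fintype.mem_piFinset.1 hs p
  rw [hsa]

theorem exists_stdSimplex_map_eval_eq {ι : Type*} [Finite ι] {α : ι → Type*} [∀ i, Fintype (α i)]
    [hfin : Fintype (∀ i, α i)] (β : ∀ i, stdSimplex ℝ (α i)) :
    ∃ t : stdSimplex ℝ (∀ i, α i), ∀ i, stdSimplex.map (fun f => f i) t = β i := by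
  classical
  have := Fintype.ofFinite ι
  obtain rfl : hfin = Pi.instFintype := Subsingleton.elim _ _
  refine ⟨⟨fun f => ∏ i, β i (f i), fun f => Finset.prod_nonneg fun i _ => (β i).2.1 (f i), ?_⟩,
    fun i => ?_⟩
  · rw [← Fintype.prod_sum fun i x => β i x]
    exact Finset.prod_eq_one fun i _ => (β i).2.2
  · ext b
    have hfiber : ({f | f i = b} : Finset (∀ i, α i)) =
        Fintype.piFinset (Function.update (fun j => (Finset.univ : Finset (α j))) i {b}) := by
      simp [Fintype.piFinset_update_eq_filter_piFinset_mem]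
    rw [stdSimplex.map_coe, FunOnFinite.linearMap_apply_apply]
    calc ∑ f : ∀ i, α i with f i = b, ∏ j, β j (f j)
        = ∏ j, ∑ x ∈ Function.update (fun j => (Finset.univ : Finset (α j))) i {b} j, β j x := by
          rw [hfiber, Finset.prod_univ_sum]
      _ = ∑ x ∈ {b}, β i x := by
          rw [Finset.prod_eq_single i (fun j _ hj => ?_) (by simp), Function.update_self]
          rw [Function.update_of_ne hj]
          exact (β j).2.2
      _ = β i b := Finset.sum_singleton _ _

theorem concaveOn_finset_inf'_apply {E J : Type*} [AddCommGroup E] [Module ℝ E] {K : Set E}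
    {s : Finset J} (hs : s.Nonempty) {f : J → E → ℝ} (hf : ∀ j ∈ s, ConcaveOn ℝ K (f j)) :
    ConcaveOn ℝ K fun t => s.inf' hs fun j => f j t := by
  have hinf := Finset.inf'_induction hs f (fun _ hg _ hh => ConcaveOn.inf hg hh) hf
  simpa only [← Finset.inf'_apply] using hinf

end Distributions

namespace KripkeGame

variable {P : Type u} {W : Type v} (G : KripkeGame.{u, v, w} P W)

noncomputable instance strategyFintype (p : P) : Fintype (G.Strategy p) :=
  haveI := G.finite_strategy p
  Fintype.ofFinite _

/-- The agents of `G`: each player acts as a separate agent in each of her classes of worlds. -/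
abbrev Agent : Type (max u v) :=
  Σ p, G.WorldClass p

/-- A behavior profile: a distribution over her strategies (or, more generally, weights) for each
agent, in place of a distribution over the pure strategies of each player. -/
abbrev BehaviorProfile : Type (max u v w) :=
  (a : G.Agent) → G.Strategy a.1 → ℝ

/-- The weights on strategies that the behavior profile `β` prescribes to the players in world
`x`. -/
def localProfile (β : G.BehaviorProfile) (x : W) (p : P) : G.Strategy p → ℝ :=
  β ⟨p, G.classOf p x⟩

/-- The behavior profile of a play, formed by the marginal distributions of its factors. -/
noncomputable def behavior [Finite W] (σ : G.Play) : G.BehaviorProfile :=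
  fun a => stdSimplex.map (fun f : G.PureStrategy a.1 => f a.2) (σ a.1)

/-- The multilinear extension of the payoff of player `p` in world `x` to weights on the
strategies. -/
noncomputable def mixedUtility [Fintype P] [DecidableEq P] (p : P) (x : W) :
    MultilinearMap ℝ (fun q => G.Strategy q → ℝ) ℝ :=
  ∑ a, G.utility p x a •
    (MultilinearMap.mkPiAlgebra ℝ P ℝ).compLinearMap fun q => LinearMap.proj (a q)

theorem mixedUtility_apply [Fintype P] [DecidableEq P] (p : P) (x : W)
    (m : ∀ q, G.Strategy q → ℝ) :
    G.mixedUtility p x m = ∑ a, (∏ q, m q (a q)) * G.utility p x a := by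
  simp [mixedUtility, mul_comm]

theorem expectedPayoff_eq [Fintype P] [DecidableEq P] [Finite W] (σ : G.Play) (p : P) (x : W) :
    G.expectedPayoff σ p x = G.mixedUtility p x (G.localProfile (G.behavior σ) x) := by
  rw [mixedUtility_apply]
  exact sum_prod_mul_comp_eq_sum_prod_map σ (fun q f => f (G.classOf q x)) (G.utility p x)

open scoped Classical in
/-- The worlds in the class of the agent `a`. -/
noncomputable def agentWorlds [Fintype W] (a : G.Agent) : Finset W :=
  {y | G.classOf a.1 y = a.2}

theorem mem_agentWorlds [Fintype W] {a : G.Agent} {y : W} :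
    y ∈ G.agentWorlds a ↔ G.classOf a.1 y = a.2 := by
  simp [agentWorlds]

theorem classFinset_eq_agentWorlds [Fintype W] (p : P) (x : W) :
    G.classFinset p x = G.agentWorlds ⟨p, G.classOf p x⟩ := by
  ext y
  simp [classFinset, mem_agentWorlds, Quotient.eq]

theorem agentWorlds_nonempty [Fintype W] (a : G.Agent) : (G.agentWorlds a).Nonempty :=
  (Quotient.exists_rep a.2).imp fun _ => G.mem_agentWorlds.2

open scoped Classical in
theorem localProfile_update [DecidableEq P] [Fintype W] (β : G.BehaviorProfile) {a : G.Agent}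
    {y : W} (hy : y ∈ G.agentWorlds a) (t : G.Strategy a.1 → ℝ) :
    G.localProfile (Function.update β a t) y = Function.update (G.localProfile β y) a.1 t := by
  obtain ⟨p, c⟩ := a
  obtain rfl : G.classOf p y = c := G.mem_agentWorlds.1 hy
  funext q
  rcases eq_or_ne q p with rfl | hq
  · simp [localProfile]
  · have hne : (⟨q, G.classOf q y⟩ : G.Agent) ≠ ⟨p, G.classOf p y⟩ := fun h =>
      hq (congrArg Sigma.fst h)
    simp [localProfile, Function.update_of_ne hq, Function.update_of_ne hne]

variable [Fintype P] [DecidableEq P] [Fintype W]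

/-- The payoff of an agent: the minimum of her expected payoffs over the worlds in her class. -/
noncomputable def agentPayoff (a : G.Agent) (β : G.BehaviorProfile) : ℝ :=
  (G.agentWorlds a).inf' (G.agentWorlds_nonempty a) fun y =>
    G.mixedUtility a.1 y (G.localProfile β y)

theorem payoff_eq_agentPayoff (σ : G.Play) (p : P) (x : W) :
    G.payoff σ p x = G.agentPayoff ⟨p, G.classOf p x⟩ (G.behavior σ) :=
  Finset.inf'_congr _ (G.classFinset_eq_agentWorlds p x) fun y _ => G.expectedPayoff_eq σ p y

theorem continuous_agentPayoff (a : G.Agent) : Continuous (G.agentPayoff a) := by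
  refine Continuous.finset_inf'_apply _ fun y _ => ?_
  simp only [mixedUtility_apply, localProfile]
  fun_prop

open scoped Classical in
theorem concaveOn_agentPayoff_update (β : G.BehaviorProfile) (a : G.Agent)
    {K : Set (G.Strategy a.1 → ℝ)} (hK : Convex ℝ K) :
    ConcaveOn ℝ K fun t => G.agentPayoff a (Function.update β a t) := by
  refine concaveOn_finset_inf'_apply _ fun y hy => ?_
  simp only [G.localProfile_update β hy]
  exact ((G.mixedUtility a.1 y).toLinearMap (G.localProfile β y) a.1).concaveOn hK

open scoped Classical in
theorem agentPayoff_behavior_update (σ : G.Play) (p : P) (τ : G.MixedStrategy p)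
    (c : G.WorldClass p) :
    G.agentPayoff ⟨p, c⟩ (G.behavior (Function.update σ p τ)) =
      G.agentPayoff ⟨p, c⟩ (Function.update (G.behavior σ) ⟨p, c⟩
        (stdSimplex.map (fun f : G.PureStrategy p => f c) τ)) := by
  refine Finset.inf'_congr _ rfl fun y hy => congrArg _ ?_
  rw [G.localProfile_update _ hy]
  obtain rfl : G.classOf p y = c := G.mem_agentWorlds.1 hy
  funext q
  rcases eq_or_ne q p with rfl | hq
  · simp [localProfile, behavior]
  · simp [localProfile, behavior, Function.update_of_ne hq]

end KripkeGame

theorem mainTheorem2 {P : Type u} {W : Type v} [Fintype P] [DecidableEq P] [Fintype W]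
    (G : KripkeGame.{u, v, w} P W) (hS : ∀ p, Nonempty (G.Strategy p)) :
    ∃ σ : G.Play, G.IsEquilibrium σ := by
  classical
  obtain ⟨β, hβ, hmax⟩ := exists_forall_update_le
    (K := fun a : G.Agent => stdSimplex ℝ (G.Strategy a.1))
    (fun a => ⟨_, single_mem_stdSimplex ℝ (hS a.1).some⟩)
    (fun _ => isCompact_stdSimplex ℝ _) (fun _ => convex_stdSimplex ℝ _)
    (fun a => (G.continuous_agentPayoff a).continuousOn)
    fun a β _ => G.concaveOn_agentPayoff_update β a (convex_stdSimplex ℝ _)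
  choose σ hσ using fun p =>
    exists_stdSimplex_map_eval_eq fun c : G.WorldClass p => ⟨β ⟨p, c⟩, hβ ⟨p, c⟩ (Set.mem_univ _)⟩
  have hbehavior : G.behavior σ = β := funext fun a => congrArg Subtype.val (hσ a.1 a.2)
  refine ⟨σ, fun p x τ => ?_⟩
  rw [G.payoff_eq_agentPayoff, G.payoff_eq_agentPayoff, G.agentPayoff_behavior_update, hbehavior]
  exact hmax _ _ (stdSimplex.map _ τ).2
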